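/- Let $S$ be a semigroup, $\sigma:S\to S$ an automorphism with $\sigma(\sigma(x))=x$ for all $x$, and $f,g,h:S\to\mathbb{C}$. For $u:S\to\mathbb{C}$ put $u^{*}=u\circ\sigma$ and $u^{e}=\frac{u+u^{*}}{2}$; $u$ is even if $u^{*}=u$ and odd if $u^{*}=-u$. A function $\chi:S\to\mathbb{C}$ is multiplicative if $\chi(xy)=\chi(x)\chi(y)$ for all $x,y$ (so $\chi=0$ is multiplicative). For multiplicative $\chi$, a function $\varphi$ is $\chi$-additive if $\varphi(xy)=\varphi(x)\chi(y)+\chi(x)\varphi(y)$ for all $x,y$ (so $0$-additive means zero on $S^2=\{xy\mid x,y\in S\}$), and $\psi$ is of type $(\chi,\tau,\varphi)$-cosine-sine, where $\tau$ is $\sigma$ or the identity, if $\varphi$ is $\chi$-additive and $\psi(x\tau(y))=\psi(x)\chi(y)+\chi(x)\psi(y)+\varphi(x)\varphi(y)$ for all $x,y$; type $(\chi,\varphi)$ means $\tau=\mathrm{id}$. Then $$f(x\sigma(y))=f(x)g(y)+g(x)f(y)+h(x)h(y)\qquad(x,y\in S)$$ holds and $f^{e},h^{e}$ are linearly independent if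 and only if $(f,g,h)$ is of at least one of the following forms. In (A)–(C), $\chi$ is a non-zero even multiplicative function and $\varphi$ is a non-zero even $\chi$-additive function; in (B), (C), $\mu$ is an even multiplicative function with $\mu\neq\chi$ (possibly $\mu=0$). (A) $f=\psi$, $g=\chi$, $h=\varphi$, where $\psi$ is non-zero, even and of type $(\chi,\varphi)$-cosine-sine. (B) $f=c^{2}\mu-c^{2}\chi-c\varphi$, $g=\chi$, $h=c\mu-c\chi$, where $c\in\mathbb{C}\setminus\{0\}$. (C) $f=-a\mu+a\chi-ab\varphi$, $g=\frac12\mu+\frac12\chi-\frac b2\varphi$, $h=\varphi$, where $a,b\in\mathbb{C}\setminus\{0\}$ and $1+ab^{2}=0$. (D) $f=\alpha\rho\chi_1+\alpha(2-\rho)\chi_2-2\alpha\chi_3$, $g=\frac{\rho}{4}\chi_1+\frac{2-\rho}{4}\chi_2+\frac12\chi_3$, $h=\frac{1}{2\lambda}\chi_1-\frac{1}{2\lambda}\chi_2$, where $\chi_1,\chi_2,\chi_3$ are pairwise different even multiplicative functions (so at most one of them is $0$) and $\alpha,\lambda,\rho\in\mathbb{C}\setminus\{0\}$ satisfy $2\alpha\lambda^{2}\rho(2-\rho)=1$.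 (E) $f=f_0$, $g=-\frac{\delta^{2}}{2}f_0+g_0+\delta h_0$, $h=-\delta f_0+h_0$, where $\delta\in\mathbb{C}$ and $(f_0,g_0,h_0)$ is of one of the forms (A)–(D). (F) $f=\Psi_0+k$, $g=-\frac{\beta^{2}}{2}\Psi_0+\beta\Phi_0-\frac{\beta^{2}}{2}k$, $h=-\beta\Psi_0+\Phi_0-\beta k$, where $\beta\in\mathbb{C}$, $\Phi_0$ is non-zero and $0$-additive, $\Psi_0$ is non-zero and of type $(0,\sigma,\Phi_0)$-cosine-sine, $k$ is odd and $0$-additive, and either $\Phi_0$ and $\Psi_0$ are both even, or $k=0$ and $\Phi_0$ is not odd. (G) $f=c^{2}\mu-c\Phi_0+k$, $g=\frac{c\beta(2-c\beta)}{2}\mu+\frac{c\beta^{2}}{2}\Phi_0-\frac{\beta^{2}}{2}k$, $h=c(1-c\beta)\mu+c\beta\Phi_0-\beta k$, where $\beta\in\mathbb{C}$, $c\in\mathbb{C}\setminus\{0\}$, $\mu$ is a non-zero even multiplicative function, $\Phi_0$ is non-zero, even and $0$-additive, and $k$ is odd and $0$-additive. -/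

import Mathlib

namespace CosSine

variable {S : Type*}

/-- `f* = f ∘ σ`. -/
def star (σ : S → S) (f : S → ℂ) : S → ℂ := fun x => f (σ x)

/-- The even part `fᵉ = (f + f*) / 2`. -/
noncomputable def evenPart (σ : S → S) (f : S → ℂ) : S → ℂ :=
  fun x => (f x + f (σ x)) / 2

/-- `f` is even: `f* = f`. -/
def IsEven (σ : S → S) (f : S → ℂ) : Prop := star σ f = f

/-- `f` is odd: `f* = -f`. -/
def IsOdd (σ : S → S) (f : S → ℂ) : Prop := star σ f = -f

/-- Multiplicative functions; the zero function is one of them. -/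
def IsMultiplicative [Semigroup S] (χ : S → ℂ) : Prop :=
  ∀ x y, χ (x * y) = χ x * χ y

/-- `φ` is `χ`-additive; for `χ = 0` this says that `φ` vanishes on `S²`. -/
def IsAdditiveFor [Semigroup S] (χ φ : S → ℂ) : Prop :=
  ∀ x y, φ (x * y) = φ x * χ y + χ x * φ y

/-- `ψ` is of type `(χ, σ, φ)`-cosine-sine. -/
def IsCosSineType [Semigroup S] (χ : S → ℂ) (σ : S → S) (φ ψ : S → ℂ) : Prop :=
  IsAdditiveFor χ φ ∧ ∀ x y, ψ (x * σ y) = ψ x * χ y + χ x * ψ y + φ x * φ y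

/-- The functional equation `f(xσ(y)) = f(x)g(y) + g(x)f(y) + h(x)h(y)`. -/
def IsSolution [Semigroup S] (σ : S → S) (f g h : S → ℂ) : Prop :=
  ∀ x y, f (x * σ y) = f x * g y + g x * f y + h x * h y

/-- Family (A). -/
def FamilyA [Semigroup S] (σ : S → S) (f g h : S → ℂ) : Prop :=
  ∃ χ φ ψ : S → ℂ,
    IsMultiplicative χ ∧ IsEven σ χ ∧ χ ≠ 0 ∧
    IsAdditiveFor χ φ ∧ IsEven σ φ ∧ φ ≠ 0 ∧
    IsCosSineType χ id φ ψ ∧ IsEven σ ψ ∧ ψ ≠ 0 ∧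
    f = ψ ∧ g = χ ∧ h = φ

/-- Family (B). -/
def FamilyB [Semigroup S] (σ : S → S) (f g h : S → ℂ) : Prop :=
  ∃ (μ χ φ : S → ℂ) (c : ℂ),
    IsMultiplicative μ ∧ IsEven σ μ ∧
    IsMultiplicative χ ∧ IsEven σ χ ∧ χ ≠ 0 ∧ χ ≠ μ ∧
    IsAdditiveFor χ φ ∧ IsEven σ φ ∧ φ ≠ 0 ∧
    c ≠ 0 ∧
    f = c ^ 2 • μ - c ^ 2 • χ - c • φ ∧
    g = χ ∧
    h = c • μ - c • χ

/-- Family (C). -/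
def FamilyC [Semigroup S] (σ : S → S) (f g h : S → ℂ) : Prop :=
  ∃ (μ χ φ : S → ℂ) (a b : ℂ),
    IsMultiplicative μ ∧ IsEven σ μ ∧
    IsMultiplicative χ ∧ IsEven σ χ ∧ χ ≠ 0 ∧ χ ≠ μ ∧
    IsAdditiveFor χ φ ∧ IsEven σ φ ∧ φ ≠ 0 ∧
    a ≠ 0 ∧ b ≠ 0 ∧ 1 + a * b ^ 2 = 0 ∧
    f = (-a) • μ + a • χ - (a * b) • φ ∧
    g = (1 / 2 : ℂ) • μ + (1 / 2 : ℂ) • χ - (b / 2) • φ ∧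
    h = φ

/-- Family (D). Since the three functions are different, at most one of them is zero. -/
def FamilyD [Semigroup S] (σ : S → S) (f g h : S → ℂ) : Prop :=
  ∃ (χ₁ χ₂ χ₃ : S → ℂ) (α lam ρ : ℂ),
    IsMultiplicative χ₁ ∧ IsEven σ χ₁ ∧
    IsMultiplicative χ₂ ∧ IsEven σ χ₂ ∧
    IsMultiplicative χ₃ ∧ IsEven σ χ₃ ∧
    χ₁ ≠ χ₂ ∧ χ₁ ≠ χ₃ ∧ χ₂ ≠ χ₃ ∧
    α ≠ 0 ∧ lam ≠ 0 ∧ ρ ≠ 0 ∧ 2 * α * lam ^ 2 * ρ * (2 - ρ) = 1 ∧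
    f = (α * ρ) • χ₁ + (α * (2 - ρ)) • χ₂ - (2 * α) • χ₃ ∧
    g = (ρ / 4) • χ₁ + ((2 - ρ) / 4) • χ₂ + (1 / 2 : ℂ) • χ₃ ∧
    h = (1 / (2 * lam)) • χ₁ - (1 / (2 * lam)) • χ₂

/-- Family (E). -/
def FamilyE [Semigroup S] (σ : S → S) (f g h : S → ℂ) : Prop :=
  ∃ (f₀ g₀ h₀ : S → ℂ) (δ : ℂ),
    (FamilyA σ f₀ g₀ h₀ ∨ FamilyB σ f₀ g₀ h₀ ∨ FamilyC σ f₀ g₀ h₀ ∨ FamilyD σ f₀ g₀ h₀) ∧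
    f = f₀ ∧
    g = (-(δ ^ 2 / 2)) • f₀ + g₀ + δ • h₀ ∧
    h = (-δ) • f₀ + h₀

/-- Family (F). -/
def FamilyF [Semigroup S] (σ : S → S) (f g h : S → ℂ) : Prop :=
  ∃ (Φ₀ Ψ₀ k : S → ℂ) (β : ℂ),
    IsAdditiveFor 0 Φ₀ ∧ Φ₀ ≠ 0 ∧
    IsCosSineType 0 σ Φ₀ Ψ₀ ∧ Ψ₀ ≠ 0 ∧
    IsAdditiveFor 0 k ∧ IsOdd σ k ∧
    ((IsEven σ Φ₀ ∧ IsEven σ Ψ₀) ∨ (k = 0 ∧ ¬ IsOdd σ Φ₀)) ∧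
    f = Ψ₀ + k ∧
    g = (-(β ^ 2 / 2)) • Ψ₀ + β • Φ₀ + (-(β ^ 2 / 2)) • k ∧
    h = (-β) • Ψ₀ + Φ₀ + (-β) • k

/-- Family (G). -/
def FamilyG [Semigroup S] (σ : S → S) (f g h : S → ℂ) : Prop :=
  ∃ (μ Φ₀ k : S → ℂ) (c β : ℂ),
    IsMultiplicative μ ∧ IsEven σ μ ∧ μ ≠ 0 ∧
    IsAdditiveFor 0 Φ₀ ∧ IsEven σ Φ₀ ∧ Φ₀ ≠ 0 ∧
    IsAdditiveFor 0 k ∧ IsOdd σ k ∧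
    c ≠ 0 ∧
    f = c ^ 2 • μ - c • Φ₀ + k ∧
    g = (c * β * (2 - c * β) / 2) • μ + (c * β ^ 2 / 2) • Φ₀ + (-(β ^ 2 / 2)) • k ∧
    h = (c * (1 - c * β)) • μ + (c * β) • Φ₀ + (-β) • k

end CosSine

/-
The transformations `(f, g, h) ↦ (f, g + δ h - (δ² / 2) f, h - δ f)` preserve the form
`f ⊗ g + g ⊗ f + h ⊗ h`, hence the set of solutions; this is the origin of `δ` in (E) and of `β` in
(F) and (G). As `fᵒ` vanishes on `S³`, comparing even and odd parts shows that either `f`, `g`, `h`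
are even or one of these transformations makes `g` vanish.

If `g = 0`, then `f(xσ(y)) = h(x)h(y)`, and associativity yields `h(xy) = t h(x)h(σ(y))` for a
constant `t`: one gets (F) for `t = 0`, and (G) with `μ = t h` otherwise.

If `f`, `g`, `h` are even, associativity makes the quadratic corrections to `g(xy) = g(x)g(y)` and
`h(xy) = g(x)h(y) + h(x)g(y)` in terms of `f` and `h` the two slots of one symmetric trilinear form.
The product is thus that of `ℂ[T] / (P)` for a monic cubic `P`, and each root of `P` gives a
multiplicative combination of `f`, `g`, `h`. The transformations translate the roots, so one of them
may be moved to `0`; a triple root then gives (A), a double one (B), and distinct roots give (D),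
unless `g` has become `0`.
-/

namespace CosSine

section LinearIndependence

variable {K X : Type*} [Field K] {u v w : X → K}

theorem linearIndependent_pair_iff_forall :
    LinearIndependent K ![u, v] ↔
      ∀ a b : K, (∀ x, a * u x + b * v x = 0) → a = 0 ∧ b = 0 := by
  simp only [LinearIndependent.pair_iff, funext_iff, Pi.add_apply, Pi.smul_apply, smul_eq_mul,
    Pi.zero_apply]

theorem linearIndependent_pair_of_forall_left (hv : v ≠ 0)
    (huv : ∀ a b : K, (∀ x, a * u x + b * v x = 0) → a = 0) : LinearIndependent K ![u, v] := by
  refine linearIndependent_pair_iff_forall.2 fun a b hab => ?_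
  obtain ⟨x, hx : v x ≠ 0⟩ := Function.ne_iff.1 hv
  have ha := huv a b hab
  exact ⟨ha, by simpa [ha, hx] using hab x⟩

theorem linearIndependent_pair_of_eq_combination (huv : LinearIndependent K ![u, v])
    {a b c d : K} (hdet : a * d ≠ b * c) {w z : X → K} (hw : w = a • u + b • v)
    (hz : z = c • u + d • v) : LinearIndependent K ![w, z] := by
  rw [hw, hz]
  exact (LinearIndependent.pair_add_smul_add_smul_iff ..).2 ⟨huv, hdet⟩

theorem eq_zero_of_notMem_span_pair (huv : LinearIndependent K ![u, v])
    (hw : w ∉ Submodule.span K {u, v}) {a b c : K}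
    (habc : ∀ x, a * u x + b * v x + c * w x = 0) : a = 0 ∧ b = 0 ∧ c = 0 := by
  have hc : c = 0 := by
    by_contra hc
    refine hw (Submodule.mem_span_pair.2 ⟨-a / c, -b / c, funext fun x => ?_⟩)
    simp only [Pi.add_apply, Pi.smul_apply, smul_eq_mul]
    field_simp
    linear_combination -habc x
  obtain ⟨ha, hb⟩ := linearIndependent_pair_iff_forall.1 huv a b fun x => by
    linear_combination habc x - w x * hc
  exact ⟨ha, hb, hc⟩

theorem exists_dual_combination (huv : LinearIndependent K ![u, v]) :
    ∃ (s t : X) (a b c d : K), a * u s + b * u t = 1 ∧ a * v s + b * v t = 0 ∧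
      c * u s + d * u t = 0 ∧ c * v s + d * v t = 1 := by
  obtain ⟨s, t, hdet⟩ : ∃ s t, u s * v t - u t * v s ≠ 0 := by
    by_contra! hdet
    have hv : ∀ t, v t = 0 := fun t =>
      (linearIndependent_pair_iff_forall.1 huv (v t) (-u t) fun s => by
        linear_combination hdet s t).1
    exact huv.ne_zero 1 (funext hv)
  obtain ⟨e, he⟩ : ∃ e, (u s * v t - u t * v s) * e = 1 := ⟨_, mul_inv_cancel₀ hdet⟩
  refine ⟨s, t, v t * e, -v s * e, -u t * e, u s * e, ?_, ?_, ?_, ?_⟩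
  · linear_combination he
  · ring
  · ring
  · linear_combination he

theorem exists_symmetric_coeffs (huv : LinearIndependent K ![u, v]) {A B C : X → K}
    (hABC : ∀ x y, u x * A y + v x * C y = A x * u y + B x * v y) :
    ∃ a b c : K, A = a • u + b • v ∧ B = b • u + c • v ∧ C = b • u + c • v := by
  obtain ⟨s, t, a, b, c, d, hau, hav, hcu, hcv⟩ := exists_dual_combination huv
  have hA : A = (a * A s + b * A t) • u + (a * C s + b * C t) • v := funext fun x => by
    simp only [Pi.add_apply, Pi.smul_apply, smul_eq_mul]
    linear_combination -A x * hau - B x * hav - a * hABC x s - b * hABC x t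
  have hB : B = (c * A s + d * A t) • u + (c * C s + d * C t) • v := funext fun x => by
    simp only [Pi.add_apply, Pi.smul_apply, smul_eq_mul]
    linear_combination -A x * hcu - B x * hcv - c * hABC x s - d * hABC x t
  have hC : C = (c * A s + d * A t) • u + (c * B s + d * B t) • v := funext fun x => by
    simp only [Pi.add_apply, Pi.smul_apply, smul_eq_mul]
    linear_combination -A x * hcu - C x * hcv + c * hABC s x + d * hABC t x
  have hAC : c * A s + d * A t = a * C s + b * C t := by
    have hs := congrFun hA s
    have ht := congrFun hA t
    simp only [Pi.add_apply, Pi.smul_apply, smul_eq_mul] at hs ht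
    linear_combination c * hs + d * ht + (a * A s + b * A t) * hcu + (a * C s + b * C t) * hcv
  have hBC : c * B s + d * B t = c * C s + d * C t := by
    have hs := congrFun hB s
    have ht := congrFun hB t
    simp only [Pi.add_apply, Pi.smul_apply, smul_eq_mul] at hs ht
    linear_combination c * hs + d * ht + (c * A s + d * A t) * hcu + (c * C s + d * C t) * hcv
  rw [hAC] at hB hC
  rw [hBC] at hC
  exact ⟨_, _, _, hA, hB, hC⟩

/- A trilinear form on a plane that is invariant under cyclic permutations is symmetric, so it is
given by four coefficients. -/
theorem exists_coeffs_of_cyclic (huv : LinearIndependent K ![u, v]) {G H : X → X → K}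
    (hGH : ∀ x y z, G x y * u z + H x y * v z = u x * G y z + v x * H y z) :
    ∃ m p q r : K,
      (∀ x y, G x y = r * u x * u y + q * (u x * v y + v x * u y) + p * v x * v y) ∧
      ∀ x y, H x y = q * u x * u y + p * (u x * v y + v x * u y) + m * v x * v y := by
  obtain ⟨s, t, a, b, c, d, hau, hav, hcu, hcv⟩ := exists_dual_combination huv
  obtain ⟨A, hA⟩ : ∃ A : X → K, ∀ y, A y = a * G y s + b * G y t := ⟨_, fun _ => rfl⟩
  obtain ⟨B, hB⟩ : ∃ B : X → K, ∀ y, B y = c * G y s + d * G y t := ⟨_, fun _ => rfl⟩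
  obtain ⟨C, hC⟩ : ∃ C : X → K, ∀ y, C y = a * H y s + b * H y t := ⟨_, fun _ => rfl⟩
  obtain ⟨D, hD⟩ : ∃ D : X → K, ∀ y, D y = c * H y s + d * H y t := ⟨_, fun _ => rfl⟩
  have hG : ∀ x y, G x y = u x * A y + v x * C y := fun x y => by
    rw [hA, hC]
    linear_combination -G x y * hau - H x y * hav + a * hGH x y s + b * hGH x y t
  have hH : ∀ x y, H x y = u x * B y + v x * D y := fun x y => by
    rw [hB, hD]
    linear_combination -G x y * hcu - H x y * hcv + c * hGH x y s + d * hGH x y t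
  have hswap : ∀ y z, A y * u z + B y * v z - G y z = 0 ∧ C y * u z + D y * v z - H y z = 0 :=
    fun y z => linearIndependent_pair_iff_forall.1 huv _ _ fun x => by
      linear_combination hGH x y z - u z * hG x y - v z * hH x y
  obtain ⟨r, q, p, rfl, rfl, rfl⟩ := exists_symmetric_coeffs huv (A := A) (B := B) (C := C)
    fun x y => by linear_combination -hG x y - (hswap x y).1
  obtain ⟨q', p', m, hBC, -, rfl⟩ := exists_symmetric_coeffs huv (A := q • u + p • v) (B := D)
    (C := D) fun x y => by linear_combination -hH x y - (hswap x y).2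
  obtain ⟨rfl, rfl⟩ := huv.eq_of_pair hBC
  simp only [Pi.add_apply, Pi.smul_apply, smul_eq_mul] at hG hH
  exact ⟨m, p, q, r, fun x y => by linear_combination hG x y,
    fun x y => by linear_combination hH x y⟩

end LinearIndependence

section Parity

variable {S : Type*} {σ : S → S} {u v : S → ℂ}

theorem isEven_iff : IsEven σ u ↔ ∀ x, u (σ x) = u x := funext_iff

theorem isOdd_iff : IsOdd σ u ↔ ∀ x, u (σ x) = -u x := funext_iff

theorem IsEven.add (hu : IsEven σ u) (hv : IsEven σ v) : IsEven σ (u + v) :=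
  congrArg₂ (· + ·) hu hv

theorem IsEven.sub (hu : IsEven σ u) (hv : IsEven σ v) : IsEven σ (u - v) :=
  congrArg₂ (· - ·) hu hv

theorem IsEven.smul (hu : IsEven σ u) (c : ℂ) : IsEven σ (c • u) :=
  congrArg (c • ·) hu

/-- The odd part `(u - u*) / 2`. -/
noncomputable def oddPart (σ : S → S) (u : S → ℂ) : S → ℂ :=
  fun x => (u x - u (σ x)) / 2

theorem evenPart_add_oddPart (σ : S → S) (u : S → ℂ) : evenPart σ u + oddPart σ u = u :=
  funext fun x => by
    simp only [Pi.add_apply, evenPart, oddPart]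
    ring

theorem isEven_evenPart (hσ : Function.Involutive σ) (u : S → ℂ) : IsEven σ (evenPart σ u) :=
  isEven_iff.2 fun x => by
    rw [evenPart, evenPart, hσ, add_comm]

theorem isOdd_oddPart (hσ : Function.Involutive σ) (u : S → ℂ) : IsOdd σ (oddPart σ u) :=
  isOdd_iff.2 fun x => by
    rw [oddPart, oddPart, hσ]
    ring

theorem IsEven.evenPart_eq (hu : IsEven σ u) : evenPart σ u = u :=
  funext fun x => by
    rw [evenPart, isEven_iff.1 hu]
    ring

theorem isEven_of_oddPart_eq_zero (hu : oddPart σ u = 0) : IsEven σ u :=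
  isEven_iff.2 fun x => by
    have hux : (u x - u (σ x)) / 2 = 0 := congrFun hu x
    linear_combination -2 * hux

theorem isOdd_of_evenPart_eq_zero (hu : evenPart σ u = 0) : IsOdd σ u :=
  isOdd_iff.2 fun x => by
    have hux : (u x + u (σ x)) / 2 = 0 := congrFun hu x
    linear_combination 2 * hux

theorem evenPart_add (σ : S → S) (u v : S → ℂ) :
    evenPart σ (u + v) = evenPart σ u + evenPart σ v :=
  funext fun x => by
    simp only [evenPart, Pi.add_apply]
    ring

theorem evenPart_smul (σ : S → S) (c : ℂ) (u : S → ℂ) : evenPart σ (c • u) = c • evenPart σ u :=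
  funext fun x => by
    simp only [evenPart, Pi.smul_apply, smul_eq_mul]
    ring

end Parity

section Twist

variable {S : Type*} {f g h : S → ℂ} {σ : S → S}

/-- The `g`-component of the transformation
`(f, g, h) ↦ (f, g + δ h - (δ² / 2) f, h - δ f)`, which preserves the form `f ⊗ g + g ⊗ f + h ⊗ h`.
These transformations form a one-parameter group. -/
noncomputable def twistG (δ : ℂ) (f g h : S → ℂ) : S → ℂ :=
  (-(δ ^ 2 / 2)) • f + g + δ • h

/-- The `h`-component of the transformation described at `twistG`. -/
def twistH (δ : ℂ) (f h : S → ℂ) : S → ℂ :=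
  (-δ) • f + h

theorem twistG_neg_twist (δ : ℂ) (f g h : S → ℂ) :
    twistG (-δ) f (twistG δ f g h) (twistH δ f h) = g :=
  funext fun x => by
    simp only [twistG, twistH, Pi.add_apply, Pi.smul_apply, smul_eq_mul]
    ring

theorem twistH_neg_twist (δ : ℂ) (f h : S → ℂ) : twistH (-δ) f (twistH δ f h) = h :=
  funext fun x => by
    simp only [twistH, Pi.add_apply, Pi.smul_apply, smul_eq_mul]
    ring

theorem IsEven.twistG (hf : IsEven σ f) (hg : IsEven σ g) (hh : IsEven σ h) (δ : ℂ) :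
    IsEven σ (twistG δ f g h) :=
  ((hf.smul _).add hg).add (hh.smul δ)

theorem IsEven.twistH (hf : IsEven σ f) (hh : IsEven σ h) (δ : ℂ) : IsEven σ (twistH δ f h) :=
  (hf.smul _).add hh

theorem IsSolution.twist [Semigroup S] (hs : IsSolution σ f g h) (δ : ℂ) :
    IsSolution σ f (twistG δ f g h) (twistH δ f h) := fun x y => by
  simp only [twistG, twistH, Pi.add_apply, Pi.smul_apply, smul_eq_mul, hs x y]
  ring

/-- A solution of the functional equation for which `fᵉ` and `hᵉ` are linearly independent. -/
structure IsNondegenerateSolution [Semigroup S] (σ : S → S) (f g h : S → ℂ) : Prop where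
  isSolution : IsSolution σ f g h
  linearIndependent : LinearIndependent ℂ ![evenPart σ f, evenPart σ h]

theorem IsNondegenerateSolution.twist [Semigroup S] (H : IsNondegenerateSolution σ f g h) (δ : ℂ) :
    IsNondegenerateSolution σ f (twistG δ f g h) (twistH δ f h) where
  isSolution := H.isSolution.twist δ
  linearIndependent := by
    rw [twistH, evenPart_add, evenPart_smul]
    exact (LinearIndependent.pair_add_smul_right_iff _).2 H.linearIndependent

theorem isSolution_iff_isSolution_id [Semigroup S] (hσ : Function.Involutive σ)
    (hf : IsEven σ f) (hg : IsEven σ g) (hh : IsEven σ h) :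
    IsSolution σ f g h ↔ IsSolution id f g h := by
  simp only [isEven_iff] at hf hg hh
  refine ⟨fun hs x y => ?_, fun hs x y => ?_⟩
  · have hxy := hs x (σ y)
    rwa [hσ, hf, hg, hh] at hxy
  · have hxy := hs x (σ y)
    rwa [hf, hg, hh] at hxy

end Twist

section NullSolutions

variable {S : Type*} [Semigroup S] {σ : S ≃* S} {f g h : S → ℂ}

theorem exists_map_mul_eq_of_null (hσ : Function.Involutive σ) (hs : IsSolution σ f 0 h) :
    ∃ t, (∀ x y, h (x * y) = t * h x * h y) ∧ (t = 0 ∨ IsEven σ h) := by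
  obtain rfl | hh := eq_or_ne h 0
  · exact ⟨0, by simp, Or.inl rfl⟩
  obtain ⟨a, ha⟩ : ∃ a, h a ≠ 0 := Function.ne_iff.1 hh
  have hf : ∀ x y, f (x * σ y) = h x * h y := fun x y => by simpa using hs x y
  have hassoc : ∀ x y z, h (x * y) * h z = h x * h (σ y * z) := fun x y z => by
    rw [← hf, ← hf, map_mul, hσ, mul_assoc]
  obtain ⟨t, ht⟩ : ∃ t, t * h a ^ 2 = h (σ a * a) := ⟨_, div_mul_cancel₀ _ (pow_ne_zero 2 ha)⟩
  have hmul : ∀ x y, h (x * y) = t * h x * h (σ y) := fun x y =>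
    mul_right_cancel₀ (pow_ne_zero 2 ha) <| by
      linear_combination h a * hassoc x y a + h x * hassoc (σ y) a a - h x * h (σ y) * ht
  obtain rfl | ht0 := eq_or_ne t 0
  · exact ⟨0, fun x y => by simpa using hmul x y, Or.inl rfl⟩
  have heven : ∀ z, h (σ z) = h z := fun z => by
    have hz := hassoc a (σ a) z
    rw [hσ, hmul, hmul, hσ] at hz
    exact mul_left_cancel₀ (mul_ne_zero (mul_ne_zero ht0 ha) ha) (by linear_combination -hz)
  exact ⟨t, fun x y => by rw [hmul, heven], Or.inr (isEven_iff.2 heven)⟩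

theorem familyF_twist_of_null (H : IsNondegenerateSolution σ f 0 h) (hh : ∀ x y, h (x * y) = 0)
    (β : ℂ) : FamilyF σ f (twistG β f 0 h) (twistH β f h) := by
  have hadd : IsAdditiveFor 0 h := fun x y => by simp [hh]
  have hodd : ¬ IsOdd σ h := fun hodd => H.linearIndependent.ne_zero 1 <| funext fun x => by
    simp [evenPart, isOdd_iff.1 hodd x]
  have hh0 : h ≠ 0 := by
    rintro rfl
    exact hodd (isOdd_iff.2 fun x => by simp)
  have hf0 : f ≠ 0 := by
    rintro rfl
    exact H.linearIndependent.ne_zero 0 (funext fun x => by simp [evenPart])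
  exact ⟨h, f, 0, β, hadd, hh0, ⟨hadd, H.isSolution⟩, hf0, fun x y => by simp,
    isOdd_iff.2 fun x => by simp, Or.inr ⟨rfl, hodd⟩, by simp, by simp [twistG], by simp [twistH]⟩

theorem familyG_twist_of_null (hσ : Function.Involutive σ) (H : IsNondegenerateSolution σ f 0 h)
    (hheven : IsEven σ h) {t : ℂ} (ht : t ≠ 0) (hh : ∀ x y, h (x * y) = t * h x * h y) (β : ℂ) :
    FamilyG σ f (twistG β f 0 h) (twistH β f h) := by
  have hf : ∀ x y, f (x * y) = h x * h y := fun x y => by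
    simpa [hσ y, isEven_iff.1 hheven y] using H.isSolution x (σ y)
  have hfe : ∀ x y, evenPart σ f (x * y) = h x * h y := fun x y => by
    rw [evenPart, map_mul, hf, hf, isEven_iff.1 hheven, isEven_iff.1 hheven]
    ring
  have hfo : ∀ x y, oddPart σ f (x * y) = 0 := fun x y => by
    rw [oddPart, map_mul, hf, hf, isEven_iff.1 hheven, isEven_iff.1 hheven, sub_self, zero_div]
  have hLI : LinearIndependent ℂ ![evenPart σ f, (-t) • evenPart σ f + h] :=
    (LinearIndependent.pair_add_smul_right_iff _).2 (hheven.evenPart_eq ▸ H.linearIndependent)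
  have hf' := evenPart_add_oddPart σ f
  refine ⟨t • h, (-t) • evenPart σ f + h, oddPart σ f, 1 / t, β, fun x y => ?_, hheven.smul t,
    smul_ne_zero ht ?_, fun x y => ?_, ((isEven_evenPart hσ f).smul _).add hheven,
    hLI.ne_zero 1, fun x y => ?_, isOdd_oddPart hσ f, one_div_ne_zero ht, ?_, ?_, ?_⟩
  · simp only [Pi.smul_apply, smul_eq_mul, hh]
    ring
  · rw [← hheven.evenPart_eq]
    exact H.linearIndependent.ne_zero 1
  · simp only [Pi.add_apply, Pi.smul_apply, smul_eq_mul, hfe, hh, Pi.zero_apply]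
    ring
  · simp [hfo]
  all_goals
    conv_lhs => rw [← hf']
    ext x
    simp only [twistG, twistH, Pi.add_apply, Pi.sub_apply, Pi.smul_apply, smul_eq_mul,
      Pi.zero_apply]
    field_simp
    ring

theorem IsNondegenerateSolution.familyF_or_familyG_of_twistG_eq_zero (hσ : Function.Involutive σ)
    (H : IsNondegenerateSolution σ f g h) {δ : ℂ} (hδ : twistG δ f g h = 0) :
    FamilyF σ f g h ∨ FamilyG σ f g h := by
  have H₀ := H.twist δ
  have hg := twistG_neg_twist δ f g h
  rw [hδ] at H₀ hg
  rw [← twistH_neg_twist δ f h, ← hg]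
  obtain ⟨t, ht, heven⟩ := exists_map_mul_eq_of_null hσ H₀.isSolution
  obtain rfl | ht0 := eq_or_ne t 0
  · exact Or.inl (familyF_twist_of_null H₀ (by simpa using ht) _)
  · exact Or.inr (familyG_twist_of_null hσ H₀ (heven.resolve_left ht0) ht0 ht _)

end NullSolutions

section EvenSolutions

variable {S : Type*} {f g h : S → ℂ} {t₁ t₂ t₃ : ℂ}

/-- The product formulas satisfied by a solution of `f(xy) = f(x)g(y) + g(x)f(y) + h(x)h(y)`. The
structure constants are expressed through `t₁`, `t₂`, `t₃` and their elementary symmetric functions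
`eᵢ` in such a way that `x ↦ f(x)(T² - e₁T + e₂/2) + h(x)T + g(x)` is multiplicative modulo
`(T - t₁)(T - t₂)(T - t₃)`. -/
structure HasStructureRoots [Semigroup S] (f g h : S → ℂ) (t₁ t₂ t₃ : ℂ) : Prop where
  isSolution : IsSolution id f g h
  map_h : ∀ x y, h (x * y) = g x * h y + h x * g y + t₁ * t₂ * t₃ * f x * f y
    - (t₁ * t₂ + t₁ * t₃ + t₂ * t₃) / 2 * (f x * h y + h x * f y) + (t₁ + t₂ + t₃) * h x * h y
  map_g : ∀ x y, g (x * y) = g x * g y + ((t₁ * t₂ + t₁ * t₃ + t₂ * t₃) ^ 2 / 4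
      - t₁ * t₂ * t₃ * (t₁ + t₂ + t₃)) * f x * f y
    + t₁ * t₂ * t₃ * (f x * h y + h x * f y) - (t₁ * t₂ + t₁ * t₃ + t₂ * t₃) / 2 * h x * h y

/-- The multiplicative function belonging to the root `t₁`, that is, the value at `T = t₁` of the
polynomial in the docstring of `HasStructureRoots`. -/
noncomputable def rootCharacter (f g h : S → ℂ) (t₁ t₂ t₃ : ℂ) : S → ℂ :=
  ((t₂ * t₃ - t₁ * t₂ - t₁ * t₃) / 2) • f + t₁ • h + g

theorem IsEven.rootCharacter {σ : S → S} (hf : IsEven σ f) (hg : IsEven σ g) (hh : IsEven σ h)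
    (t₁ t₂ t₃ : ℂ) : IsEven σ (rootCharacter f g h t₁ t₂ t₃) :=
  ((hf.smul _).add (hh.smul t₁)).add hg

theorem rootCharacter_sub_rootCharacter :
    rootCharacter f g h t₁ t₂ t₃ - rootCharacter f g h t₂ t₃ t₁ =
      (t₁ - t₂) • ((-t₃) • f + h) := by
  ext x
  simp only [rootCharacter, Pi.add_apply, Pi.sub_apply, Pi.smul_apply, smul_eq_mul]
  ring

theorem rootCharacter_ne_rootCharacter (hLI : LinearIndependent ℂ ![f, h]) (h₁₂ : t₁ ≠ t₂)
    (t₃ : ℂ) : rootCharacter f g h t₁ t₂ t₃ ≠ rootCharacter f g h t₂ t₃ t₁ := by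
  rw [← sub_ne_zero, rootCharacter_sub_rootCharacter]
  exact smul_ne_zero (sub_ne_zero.2 h₁₂)
    (((LinearIndependent.pair_add_smul_right_iff (-t₃)).2 hLI).ne_zero 1)

variable [Semigroup S]

theorem exists_structure_constants (hs : IsSolution id f g h)
    (hLI : LinearIndependent ℂ ![f, h]) :
    ∃ m p q : ℂ,
      (∀ x y, g (x * y) = g x * g y + (p ^ 2 - q * m) * f x * f y
        + q * (f x * h y + h x * f y) + p * h x * h y) ∧
      ∀ x y, h (x * y) = g x * h y + h x * g y + q * f x * f y
        + p * (f x * h y + h x * f y) + m * h x * h y := by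
  have hf : ∀ x y, f (x * y) = f x * g y + g x * f y + h x * h y := hs
  obtain ⟨m, p, q, r, hg, hh⟩ := exists_coeffs_of_cyclic hLI
    (G := fun x y => g (x * y) - g x * g y)
    (H := fun x y => h (x * y) - g x * h y - h x * g y) fun x y z => by
      have hxyz : f (x * y * z) = f (x * (y * z)) := by rw [mul_assoc]
      simp only [hf] at hxyz
      linear_combination hxyz
  replace hg : ∀ x y, g (x * y) = g x * g y + r * f x * f y + q * (f x * h y + h x * f y)
      + p * h x * h y := fun x y => by linear_combination hg x y
  replace hh : ∀ x y, h (x * y) = g x * h y + h x * g y + q * f x * f y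
      + p * (f x * h y + h x * f y) + m * h x * h y := fun x y => by linear_combination hh x y
  have hassoc : ∀ x y z, (r - (p ^ 2 - q * m)) * f y * (f x * h z - f z * h x) = 0 :=
    fun x y z => by
      have hxyz : h (x * y * z) = h (x * (y * z)) := by rw [mul_assoc]
      simp only [hf, hg, hh] at hxyz
      linear_combination hxyz
  obtain ⟨a, ha⟩ : ∃ a, f a ≠ 0 := Function.ne_iff.1 (hLI.ne_zero 0)
  obtain ⟨-, hr⟩ := linearIndependent_pair_iff_forall.1 hLI ((r - (p ^ 2 - q * m)) * f a * h a)
    (-((r - (p ^ 2 - q * m)) * f a * f a)) fun x => by linear_combination hassoc x a a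
  have hr' : r = p ^ 2 - q * m := by simpa [ha, sub_eq_zero] using hr
  exact ⟨m, p, q, hr' ▸ hg, hh⟩

theorem exists_eq_elementary_symmetric (e₁ e₂ e₃ : ℂ) :
    ∃ t₁ t₂ t₃ : ℂ, t₁ + t₂ + t₃ = e₁ ∧ t₁ * t₂ + t₁ * t₃ + t₂ * t₃ = e₂ ∧ t₁ * t₂ * t₃ = e₃ := by
  let P : Cubic ℂ := ⟨1, -e₁, e₂, -e₃⟩
  have ha : P.a ≠ 0 := one_ne_zero
  obtain ⟨t₁, t₂, t₃, h₃⟩ := (Cubic.splits_iff_roots_eq_three (φ := RingHom.id ℂ) ha).1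
    (IsAlgClosed.splits _)
  have hb := Cubic.b_eq_three_roots ha h₃
  have hc := Cubic.c_eq_three_roots ha h₃
  have hd := Cubic.d_eq_three_roots ha h₃
  simp only [P, RingHom.id_apply] at hb hc hd
  exact ⟨t₁, t₂, t₃, by linear_combination hb, by linear_combination -hc,
    by linear_combination hd⟩

theorem exists_hasStructureRoots (hs : IsSolution id f g h)
    (hLI : LinearIndependent ℂ ![f, h]) : ∃ t₁ t₂ t₃, HasStructureRoots f g h t₁ t₂ t₃ := by
  obtain ⟨m, p, q, hg, hh⟩ := exists_structure_constants hs hLI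
  obtain ⟨t₁, t₂, t₃, h₁, h₂, h₃⟩ := exists_eq_elementary_symmetric m (-2 * p) q
  refine ⟨t₁, t₂, t₃, hs, fun x y => ?_, fun x y => ?_⟩
  · rw [h₁, h₂, h₃, hh]
    ring
  · rw [h₁, h₂, h₃, hg]
    ring

theorem familyE_of_twist {σ : S → S} (δ : ℂ)
    (H : FamilyA σ f (twistG δ f g h) (twistH δ f h) ∨
      FamilyB σ f (twistG δ f g h) (twistH δ f h) ∨
      FamilyC σ f (twistG δ f g h) (twistH δ f h) ∨
      FamilyD σ f (twistG δ f g h) (twistH δ f h)) : FamilyE σ f g h :=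
  ⟨f, _, _, -δ, H, rfl, (twistG_neg_twist δ f g h).symm, (twistH_neg_twist δ f h).symm⟩

namespace HasStructureRoots

theorem rotate (H : HasStructureRoots f g h t₁ t₂ t₃) : HasStructureRoots f g h t₂ t₃ t₁ where
  isSolution := H.isSolution
  map_h x y := by
    rw [H.map_h]
    ring
  map_g x y := by
    rw [H.map_g]
    ring

theorem twist (H : HasStructureRoots f g h t₁ t₂ t₃) (δ : ℂ) :
    HasStructureRoots f (twistG δ f g h) (twistH δ f h) (t₁ - δ) (t₂ - δ) (t₃ - δ) where
  isSolution := H.isSolution.twist δ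
  map_h x y := by
    have hf : f (x * y) = _ := H.isSolution x y
    simp only [twistG, twistH, Pi.add_apply, Pi.smul_apply, smul_eq_mul, hf, H.map_h]
    ring
  map_g x y := by
    have hf : f (x * y) = _ := H.isSolution x y
    simp only [twistG, twistH, Pi.add_apply, Pi.smul_apply, smul_eq_mul, hf, H.map_h, H.map_g]
    ring

theorem isMultiplicative_rootCharacter (H : HasStructureRoots f g h t₁ t₂ t₃) :
    IsMultiplicative (rootCharacter f g h t₁ t₂ t₃) := fun x y => by
  have hf : f (x * y) = _ := H.isSolution x y
  simp only [rootCharacter, Pi.add_apply, Pi.smul_apply, smul_eq_mul, hf, H.map_g, H.map_h]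
  ring

variable {σ : S → S}

theorem familyA (H : HasStructureRoots f g h 0 0 0) (hLI : LinearIndependent ℂ ![f, h])
    (hf : IsEven σ f) (hg : IsEven σ g) (hh : IsEven σ h) (hg0 : g ≠ 0) : FamilyA σ f g h := by
  have hadd : IsAdditiveFor g h := fun x y => by
    rw [H.map_h]
    ring
  refine ⟨g, h, f, fun x y => ?_, hg, hg0, hadd, hh, hLI.ne_zero 1, ⟨hadd, H.isSolution⟩, hf,
    hLI.ne_zero 0, rfl, rfl, rfl⟩
  rw [H.map_g]
  ring

theorem familyB {m : ℂ} (H : HasStructureRoots f g h 0 0 m) (hLI : LinearIndependent ℂ ![f, h])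
    (hf : IsEven σ f) (hg : IsEven σ g) (hh : IsEven σ h) (hm : m ≠ 0) (hg0 : g ≠ 0) :
    FamilyB σ f g h := by
  have hfmul : ∀ x y, f (x * y) = f x * g y + g x * f y + h x * h y := H.isSolution
  have hgmul : IsMultiplicative g := fun x y => by
    rw [H.map_g]
    ring
  have hne : g ≠ g + m • h := by
    simpa using smul_ne_zero hm (hLI.ne_zero 1)
  have hφ0 : (-m) • f + h ≠ 0 := ((LinearIndependent.pair_add_smul_right_iff _).2 hLI).ne_zero 1
  refine ⟨g + m • h, g, (-m) • f + h, 1 / m, fun x y => ?_, hg.add (hh.smul m), hgmul, hg, hg0,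
    hne, fun x y => ?_, (hf.smul _).add hh, hφ0, one_div_ne_zero hm, ?_, rfl, ?_⟩
  · simp only [Pi.add_apply, Pi.smul_apply, smul_eq_mul, hgmul x, H.map_h]
    ring
  · simp only [Pi.add_apply, Pi.smul_apply, smul_eq_mul, hfmul, H.map_h]
    ring
  all_goals
    ext x
    simp only [Pi.add_apply, Pi.sub_apply, Pi.smul_apply, smul_eq_mul]
    field_simp
    ring

theorem familyD (H : HasStructureRoots f g h t₁ t₂ 0) (hLI : LinearIndependent ℂ ![f, h])
    (hf : IsEven σ f) (hg : IsEven σ g) (hh : IsEven σ h) (h₁₂ : t₁ ≠ t₂) (h₁ : t₁ ≠ 0)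
    (h₂ : t₂ ≠ 0) : FamilyD σ f g h := by
  have h₁₂' : t₁ - t₂ ≠ 0 := sub_ne_zero.2 h₁₂
  refine ⟨rootCharacter f g h t₁ t₂ 0, rootCharacter f g h t₂ 0 t₁, rootCharacter f g h 0 t₁ t₂,
    -1 / (2 * t₁ * t₂), (t₁ - t₂) / 2, -2 * t₂ / (t₁ - t₂), H.isMultiplicative_rootCharacter,
    hf.rootCharacter hg hh .., H.rotate.isMultiplicative_rootCharacter,
    hf.rootCharacter hg hh .., H.rotate.rotate.isMultiplicative_rootCharacter,
    hf.rootCharacter hg hh .., rootCharacter_ne_rootCharacter hLI h₁₂ 0,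
    (rootCharacter_ne_rootCharacter hLI h₁.symm t₂).symm, rootCharacter_ne_rootCharacter hLI h₂ t₁,
    by simp [h₁, h₂], by simp [h₁₂'], by simp [h₁₂', h₂], ?_, ?_, ?_, ?_⟩
  · field_simp
    ring
  all_goals
    ext x
    simp only [rootCharacter, Pi.add_apply, Pi.sub_apply, Pi.smul_apply, smul_eq_mul]
    field_simp
    ring

theorem familyE_of_ne (H : HasStructureRoots f g h t₁ t₂ t₃) (hLI : LinearIndependent ℂ ![f, h])
    (hf : IsEven σ f) (hg : IsEven σ g) (hh : IsEven σ h)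
    (h₁₂ : t₁ ≠ t₂) (h₁₃ : t₁ ≠ t₃) (h₂₃ : t₂ ≠ t₃) : FamilyE σ f g h := by
  have H₀ := H.twist t₃
  rw [sub_self] at H₀
  exact familyE_of_twist t₃ <| Or.inr <| Or.inr <| Or.inr <|
    H₀.familyD ((LinearIndependent.pair_add_smul_right_iff _).2 hLI) hf (hf.twistG hg hh t₃)
      (hf.twistH hh t₃) (by simpa using h₁₂) (sub_ne_zero.2 h₁₃) (sub_ne_zero.2 h₂₃)

theorem twistG_eq_zero_or_familyE (H : HasStructureRoots f g h t₁ t₁ t₂)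
    (hLI : LinearIndependent ℂ ![f, h]) (hf : IsEven σ f) (hg : IsEven σ g) (hh : IsEven σ h) :
    twistG t₁ f g h = 0 ∨ FamilyE σ f g h := by
  refine or_iff_not_imp_left.2 fun hg0 => familyE_of_twist t₁ ?_
  have H₀ := H.twist t₁
  have hLI₀ := (LinearIndependent.pair_add_smul_right_iff (-t₁)).2 hLI
  have hg₀ := hf.twistG hg hh t₁
  have hh₀ := hf.twistH hh t₁
  rw [sub_self] at H₀
  obtain rfl | h₁₂ := eq_or_ne t₂ t₁
  · exact Or.inl ((sub_self t₂ ▸ H₀).familyA hLI₀ hf hg₀ hh₀ hg0)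
  · exact Or.inr (Or.inl (H₀.familyB hLI₀ hf hg₀ hh₀ (sub_ne_zero.2 h₁₂) hg0))

end HasStructureRoots

theorem exists_twistG_eq_zero_or_familyE_of_isEven {σ : S → S} (hσ : Function.Involutive σ)
    (H : IsNondegenerateSolution σ f g h) (hf : IsEven σ f) (hg : IsEven σ g)
    (hh : IsEven σ h) : (∃ δ, twistG δ f g h = 0) ∨ FamilyE σ f g h := by
  have hLI : LinearIndependent ℂ ![f, h] := by
    simpa only [hf.evenPart_eq, hh.evenPart_eq] using H.linearIndependent
  have hdouble : ∀ t s, HasStructureRoots f g h t t s →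
      (∃ δ, twistG δ f g h = 0) ∨ FamilyE σ f g h := fun t s hR =>
    (hR.twistG_eq_zero_or_familyE hLI hf hg hh).imp_left fun ht => ⟨t, ht⟩
  obtain ⟨t₁, t₂, t₃, hR⟩ := exists_hasStructureRoots
    ((isSolution_iff_isSolution_id hσ hf hg hh).1 H.isSolution) hLI
  obtain rfl | h₁₂ := eq_or_ne t₁ t₂
  · exact hdouble _ _ hR
  obtain rfl | h₁₃ := eq_or_ne t₁ t₃
  · exact hdouble _ _ hR.rotate.rotate
  obtain rfl | h₂₃ := eq_or_ne t₂ t₃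
  · exact hdouble _ _ hR.rotate
  · exact Or.inr (hR.familyE_of_ne hLI hf hg hh h₁₂ h₁₃ h₂₃)

end EvenSolutions

section ParityDecomposition

variable {S : Type*} [Semigroup S] {σ : S ≃* S} {f g h : S → ℂ} {a s : ℂ}

local notation:max u:max "ᵉ" => evenPart σ u
local notation:max u:max "ᵒ" => oddPart σ u

theorem evenPart_map (hσ : Function.Involutive σ) (u : S → ℂ) (x : S) : uᵉ (σ x) = uᵉ x :=
  isEven_iff.1 (isEven_evenPart hσ u) x

theorem oddPart_map (hσ : Function.Involutive σ) (u : S → ℂ) (x : S) : uᵒ (σ x) = -uᵒ x :=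
  isOdd_iff.1 (isOdd_oddPart hσ u) x

namespace IsSolution

theorem map_mul (hσ : Function.Involutive σ) (hs : IsSolution σ f g h) (x y : S) :
    f (x * y) = f x * g (σ y) + g x * f (σ y) + h x * h (σ y) := by
  rw [← hs, hσ]

theorem evenPart_mul (hσ : Function.Involutive σ) (hs : IsSolution σ f g h) (x y : S) :
    fᵉ (x * y) = fᵉ x * gᵉ y + gᵉ x * fᵉ y + hᵉ x * hᵉ y
      - fᵒ x * gᵒ y - gᵒ x * fᵒ y - hᵒ x * hᵒ y := by
  simp only [evenPart, oddPart, _root_.map_mul, hs.map_mul hσ, hσ y]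
  ring

theorem oddPart_mul (hσ : Function.Involutive σ) (hs : IsSolution σ f g h) (x y : S) :
    fᵒ (x * y) = fᵒ x * gᵉ y + gᵒ x * fᵉ y + hᵒ x * hᵉ y
      - fᵉ x * gᵒ y - gᵉ x * fᵒ y - hᵉ x * hᵒ y := by
  simp only [evenPart, oddPart, _root_.map_mul, hs.map_mul hσ, hσ y]
  ring

theorem evenPart_mul_add_evenPart_mul_map (hσ : Function.Involutive σ) (hs : IsSolution σ f g h)
    (x y : S) :
    fᵉ (x * y) + fᵉ (x * σ y) = 2 * (fᵉ x * gᵉ y + gᵉ x * fᵉ y + hᵉ x * hᵉ y) := by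
  rw [hs.evenPart_mul hσ, hs.evenPart_mul hσ]
  simp only [evenPart_map hσ, oddPart_map hσ]
  ring

theorem oddPart_mul_mul (hσ : Function.Involutive σ) (hs : IsSolution σ f g h) (x y z : S) :
    fᵒ (x * (y * z)) = 0 := by
  have hcomm : ∀ x y, f (x * y) = f (σ (y * x)) := fun x y => by
    rw [_root_.map_mul, hs, hs.map_mul hσ]
    ring
  have hcyc : f (x * (y * z)) = f (y * (z * x)) := by
    rw [← mul_assoc, hcomm, ← mul_assoc, ← hcomm]
  have hmap : f (y * (z * x)) = f (σ (x * (y * z))) := by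
    rw [← mul_assoc, hcomm]
  rw [oddPart, hcyc, hmap, sub_self, zero_div]

theorem parity_relations (hσ : Function.Involutive σ) (hs : IsSolution σ f g h) {b : S}
    (hb : ∀ x, fᵒ (x * b) = 0) (x : S) :
    fᵉ x * gᵒ b + gᵉ x * fᵒ b + hᵉ x * hᵒ b = 0 ∧
      fᵒ x * gᵉ b + gᵒ x * fᵉ b + hᵒ x * hᵉ b = 0 := by
  have hx := hb x
  have hσx := hb (σ x)
  rw [hs.oddPart_mul hσ] at hx hσx
  simp only [evenPart_map hσ, oddPart_map hσ] at hσx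
  exact ⟨by linear_combination (-hx - hσx) / 2, by linear_combination (hx - hσx) / 2⟩

end IsSolution

namespace IsNondegenerateSolution

theorem isEven_of_notMem_span (hσ : Function.Involutive σ) (H : IsNondegenerateSolution σ f g h)
    (hg : gᵉ ∉ Submodule.span ℂ {fᵉ, hᵉ}) : IsEven σ f ∧ IsEven σ g ∧ IsEven σ h := by
  have hodd : ∀ b, (∀ x, fᵒ (x * b) = 0) → gᵒ b = 0 ∧ hᵒ b = 0 ∧ fᵒ b = 0 := fun b hb =>
    eq_zero_of_notMem_span_pair H.linearIndependent hg fun x => by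
      linear_combination (H.isSolution.parity_relations hσ hb x).1
  have hfo : ∀ x y, fᵒ (x * y) = 0 := fun x y =>
    (hodd _ fun z => H.isSolution.oddPart_mul_mul hσ z x y).2.2
  have hzero := fun b => hodd b fun x => hfo x b
  exact ⟨isEven_of_oddPart_eq_zero (funext fun b => (hzero b).2.2),
    isEven_of_oddPart_eq_zero (funext fun b => (hzero b).1),
    isEven_of_oddPart_eq_zero (funext fun b => (hzero b).2.1)⟩

theorem exists_evenPart_mul_ne_zero (hσ : Function.Involutive σ)
    (H : IsNondegenerateSolution σ f g h) (hg : ∀ x, gᵉ x = a * fᵉ x) :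
    ∃ x y, fᵉ (x * y) ≠ 0 := by
  by_contra! hzero
  have hh : ∀ y, hᵉ y = 0 := fun y =>
    (linearIndependent_pair_iff_forall.1 H.linearIndependent (2 * a * fᵉ y) (hᵉ y) fun x => by
      have hxy := H.isSolution.evenPart_mul_add_evenPart_mul_map hσ x y
      rw [hzero, hzero, hg, hg] at hxy
      linear_combination -hxy / 2).2
  exact H.linearIndependent.ne_zero 1 (funext hh)

theorem eq_zero_or_isEven_of_oddPart_eq_zero (hσ : Function.Involutive σ)
    (H : IsNondegenerateSolution σ f g h) (hg : ∀ x, gᵉ x = a * fᵉ x) (hh : ∀ x, hᵒ x = 0) :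
    g = 0 ∨ (IsEven σ f ∧ IsEven σ g ∧ IsEven σ h) := by
  have hs := H.isSolution
  obtain ⟨c, d, hcd⟩ := H.exists_evenPart_mul_ne_zero hσ hg
  have hgo : ∀ x, gᵒ x = -a * fᵒ x := fun x => mul_right_cancel₀ hcd <| by
    have hx := (hs.parity_relations hσ (fun z => hs.oddPart_mul_mul hσ z c d) x).2
    rw [hg, hh] at hx
    linear_combination hx
  have hfo : ∀ x y, fᵒ (x * y) = 0 := fun x y => by
    rw [hs.oddPart_mul hσ, hgo, hgo, hg, hg, hh, hh]
    ring
  have hfe : ∀ x y, fᵉ (x * y) = 2 * a * (fᵉ x * fᵉ y + fᵒ x * fᵒ y) + hᵉ x * hᵉ y := fun x y => by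
    rw [hs.evenPart_mul hσ, hgo, hgo, hg, hg, hh, hh]
    ring
  -- Compare the parts of `fᵉ ((x * y) * z) = fᵉ (x * (y * z))` that are odd in `z`.
  have hafo : ∀ y z, 4 * a ^ 2 * fᵒ y * fᵒ z = 0 := fun y z =>
    (linearIndependent_pair_iff_forall.1 H.linearIndependent _ ((hᵉ (y * z) - hᵉ (y * σ z)) / 2)
      fun x => by
        have hz := hfe (x * y) z
        have hσz := hfe (x * y) (σ z)
        rw [mul_assoc, hfe x, hfe y, hfo, hfo] at hz hσz
        rw [evenPart_map hσ, oddPart_map hσ, evenPart_map hσ] at hσz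
        linear_combination (hz - hσz) / 2).1
  obtain rfl | ha := eq_or_ne a 0
  · refine Or.inl ?_
    rw [← evenPart_add_oddPart σ g]
    exact funext fun x => by simp [hg, hgo]
  · have hf0 : ∀ x, fᵒ x = 0 := fun x => by simpa [ha] using hafo x x
    exact Or.inr ⟨isEven_of_oddPart_eq_zero (funext hf0),
      isEven_of_oddPart_eq_zero (funext fun x => by simp [hgo, hf0]),
      isEven_of_oddPart_eq_zero (funext hh)⟩

theorem exists_parity_coeff (hσ : Function.Involutive σ) (H : IsNondegenerateSolution σ f g h)
    (hg : ∀ x, gᵉ x = a * fᵉ x) {w : S} (hw : hᵒ w ≠ 0) :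
    ∃ s, (∀ x, gᵒ x = s * hᵒ x - a * fᵒ x) ∧ (∀ x y, hᵉ (x * y) = -s * fᵉ (x * y)) ∧
      ∀ x y, hᵒ (x * y) = 0 := by
  have hs := H.isSolution
  have hrel := fun x y => hs.parity_relations hσ fun z => hs.oddPart_mul_mul hσ z x y
  obtain ⟨c, d, hcd⟩ := H.exists_evenPart_mul_ne_zero hσ hg
  obtain ⟨s, hscd⟩ : ∃ s, s * fᵉ (c * d) = -hᵉ (c * d) := ⟨_, div_mul_cancel₀ _ hcd⟩
  have hgo : ∀ x, gᵒ x = s * hᵒ x - a * fᵒ x := fun x => mul_right_cancel₀ hcd <| by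
    have hx := (hrel c d x).2
    rw [hg] at hx
    linear_combination hx - hᵒ x * hscd
  refine ⟨s, hgo, fun x y => mul_left_cancel₀ hw ?_, fun x y => ?_⟩
  · have hxy := (hrel x y w).2
    rw [hg, hgo] at hxy
    linear_combination hxy
  · refine (linearIndependent_pair_iff_forall.1 H.linearIndependent
      (gᵒ (x * y) + a * fᵒ (x * y)) _ fun z => ?_).2
    have hz := (hrel x y z).1
    rw [hg] at hz
    linear_combination hz

theorem parity_associativity (hσ : Function.Involutive σ) (H : IsNondegenerateSolution σ f g h)
    (hg : ∀ x, gᵉ x = a * fᵉ x) (hgo : ∀ x, gᵒ x = s * hᵒ x - a * fᵒ x)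
    (hhe : ∀ x y, hᵉ (x * y) = -s * fᵉ (x * y)) (hho : ∀ x y, hᵒ (x * y) = 0) (x y c d : S) :
    (2 * a * fᵉ x - s * hᵉ x) * (2 * a * fᵉ y - s * hᵉ y) * fᵉ (c * d) =
        (2 * a + s ^ 2) * fᵉ (x * y) * fᵉ (c * d) ∧
      ((2 * a * fᵉ x - s * hᵉ x) * (s * hᵒ y - 2 * a * fᵒ y) + 2 * a * fᵒ (x * y)) *
        fᵒ (c * d) = 0 := by
  have hfe : ∀ x c d, fᵉ (x * (c * d)) =
      (2 * a * fᵉ x - s * hᵉ x) * fᵉ (c * d) - (s * hᵒ x - 2 * a * fᵒ x) * fᵒ (c * d) :=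
    fun x c d => by
      rw [H.isSolution.evenPart_mul hσ, hg, hg, hgo, hgo, hhe, hho]
      ring
  have hassoc : ∀ c d,
      (2 * a * fᵉ x - s * hᵉ x) *
          ((2 * a * fᵉ y - s * hᵉ y) * fᵉ (c * d) - (s * hᵒ y - 2 * a * fᵒ y) * fᵒ (c * d)) =
        (2 * a + s ^ 2) * fᵉ (x * y) * fᵉ (c * d) + 2 * a * fᵒ (x * y) * fᵒ (c * d) :=
    fun c d => by
      have hxy := hfe (x * y) c d
      rw [mul_assoc, hfe x y, hfe y, H.isSolution.oddPart_mul_mul hσ, hhe, hho] at hxy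
      linear_combination hxy
  have hcd := hassoc c d
  have hσcd := hassoc (σ c) (σ d)
  rw [← map_mul, evenPart_map hσ, oddPart_map hσ] at hσcd
  exact ⟨by linear_combination (hcd + hσcd) / 2, by linear_combination (hσcd - hcd) / 2⟩

theorem parity_coeff_eq_zero (hσ : Function.Involutive σ) (H : IsNondegenerateSolution σ f g h)
    (hg : ∀ x, gᵉ x = a * fᵉ x) (hgo : ∀ x, gᵒ x = s * hᵒ x - a * fᵒ x)
    (hhe : ∀ x y, hᵉ (x * y) = -s * fᵉ (x * y)) (hho : ∀ x y, hᵒ (x * y) = 0) : a = 0 := by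
  obtain ⟨c, d, hcd⟩ := H.exists_evenPart_mul_ne_zero hσ hg
  have hmul : ∀ x y, (2 * a * fᵉ x - s * hᵉ x) * (2 * a * fᵉ y - s * hᵉ y) =
      (2 * a + s ^ 2) * fᵉ (x * y) := fun x y =>
    mul_right_cancel₀ hcd (H.parity_associativity hσ hg hgo hhe hho x y c d).1
  have hsymm : ∀ x y, (2 * a * fᵉ x - s * hᵉ x) * (2 * a * fᵉ y - s * hᵉ y) =
      (2 * a + s ^ 2) * (2 * a * fᵉ x * fᵉ y + hᵉ x * hᵉ y) := fun x y => by
    have hy := hmul x y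
    have hσy := hmul x (σ y)
    have hadd := H.isSolution.evenPart_mul_add_evenPart_mul_map hσ x y
    rw [evenPart_map hσ, evenPart_map hσ] at hσy
    rw [hg, hg] at hadd
    linear_combination (hy + hσy) / 2 + (2 * a + s ^ 2) / 2 * hadd
  have hcoeff : ∀ y, -s * (2 * a * fᵉ y - s * hᵉ y) - (2 * a + s ^ 2) * hᵉ y = 0 := fun y =>
    (linearIndependent_pair_iff_forall.1 H.linearIndependent
      (2 * a * (2 * a * fᵉ y - s * hᵉ y) - (2 * a + s ^ 2) * (2 * a * fᵉ y)) _ fun x => by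
        linear_combination hsymm x y).2
  have ha : -2 * a = 0 :=
    (linearIndependent_pair_iff_forall.1 H.linearIndependent (-2 * a * s) (-2 * a) fun y => by
      linear_combination hcoeff y).2
  simpa using ha

theorem eq_zero_of_oddPart_ne_zero (hσ : Function.Involutive σ)
    (H : IsNondegenerateSolution σ f g h) (hg : ∀ x, gᵉ x = a * fᵉ x) {w : S} (hw : hᵒ w ≠ 0) :
    g = 0 := by
  obtain ⟨s, hgo, hhe, hho⟩ := H.exists_parity_coeff hσ hg hw
  obtain rfl := H.parity_coeff_eq_zero hσ hg hgo hhe hho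
  obtain ⟨c, d, hcd⟩ : ∃ c d, fᵒ (c * d) ≠ 0 := by
    by_contra! hfo
    refine hw (linearIndependent_pair_iff_forall.1 H.linearIndependent (gᵒ w) _ fun x => ?_).2
    have hx := (H.isSolution.parity_relations hσ (fun z => hfo z w) x).1
    rw [hg] at hx
    linear_combination hx
  obtain ⟨x, hx⟩ : ∃ x, hᵉ x ≠ 0 := Function.ne_iff.1 (H.linearIndependent.ne_zero 1)
  have hs : s = 0 := by
    simpa [hx, hw, hcd] using (H.parity_associativity hσ hg hgo hhe hho x w c d).2
  rw [← evenPart_add_oddPart σ g]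
  exact funext fun x => by simp [hg, hgo, hs]

theorem exists_twistG_eq_zero_or_isEven (hσ : Function.Involutive σ)
    (H : IsNondegenerateSolution σ f g h) :
    (∃ δ, twistG δ f g h = 0) ∨ (IsEven σ f ∧ IsEven σ g ∧ IsEven σ h) := by
  by_cases hspan : gᵉ ∈ Submodule.span ℂ {fᵉ, hᵉ}
  swap
  · exact Or.inr (H.isEven_of_notMem_span hσ hspan)
  obtain ⟨a, δ, hg⟩ := Submodule.mem_span_pair.1 hspan
  have H₀ := H.twist (-δ)
  have hg₀ : ∀ x, (twistG (-δ) f g h)ᵉ x = (a - δ ^ 2 / 2) * fᵉ x := fun x => by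
    simp only [twistG, evenPart_add, evenPart_smul, ← hg, Pi.add_apply, Pi.smul_apply, smul_eq_mul]
    ring
  by_cases hh₀ : ∀ x, (twistH (-δ) f h)ᵒ x = 0
  · refine (H₀.eq_zero_or_isEven_of_oddPart_eq_zero hσ hg₀ hh₀).imp (fun hzero => ⟨-δ, hzero⟩) ?_
    rintro ⟨hf, hg₁, hh₁⟩
    have hg₂ := hf.twistG hg₁ hh₁ (-(-δ))
    have hh₂ := hf.twistH hh₁ (-(-δ))
    rw [twistG_neg_twist] at hg₂
    rw [twistH_neg_twist] at hh₂
    exact ⟨hf, hg₂, hh₂⟩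
  · obtain ⟨w, hw⟩ := not_forall.1 hh₀
    exact Or.inl ⟨-δ, H₀.eq_zero_of_oddPart_ne_zero hσ hg₀ hw⟩

end IsNondegenerateSolution

end ParityDecomposition

section Families

variable {S : Type*} [Semigroup S] {χ μ φ χ₁ χ₂ χ₃ f g h : S → ℂ}

theorem linearIndependent_sub_of_isAdditiveFor (hχ : IsMultiplicative χ) (hμ : IsMultiplicative μ)
    (hφ : IsAdditiveFor χ φ) (hμχ : μ ≠ χ) (hφ0 : φ ≠ 0) :
    LinearIndependent ℂ ![μ - χ, φ] := by
  refine linearIndependent_pair_of_forall_left hφ0 fun a b hab => ?_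
  simp only [Pi.sub_apply] at hab
  obtain ⟨w, hw : μ w - χ w ≠ 0⟩ := Function.ne_iff.1 (sub_ne_zero.2 hμχ)
  have hww : a * (μ w - χ w) ^ 2 = 0 := by
    have hab_sq := hab (w * w)
    rw [hμ, hχ, hφ] at hab_sq
    linear_combination hab_sq - 2 * χ w * hab w
  simpa [hw] using hww

theorem linearIndependent_sub_of_isMultiplicative (h₁ : IsMultiplicative χ₁)
    (h₂ : IsMultiplicative χ₂) (h₃ : IsMultiplicative χ₃) (h₁₂ : χ₁ ≠ χ₂) (h₁₃ : χ₁ ≠ χ₃)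
    (h₂₃ : χ₂ ≠ χ₃) : LinearIndependent ℂ ![χ₁ - χ₃, χ₂ - χ₃] := by
  refine linearIndependent_pair_of_forall_left (sub_ne_zero.2 h₂₃) fun a b hab => ?_
  simp only [Pi.sub_apply] at hab
  obtain ⟨x, hx : χ₁ x - χ₃ x ≠ 0⟩ := Function.ne_iff.1 (sub_ne_zero.2 h₁₃)
  obtain ⟨y, hy : χ₁ y - χ₂ y ≠ 0⟩ := Function.ne_iff.1 (sub_ne_zero.2 h₁₂)
  have hprod : a * (χ₁ x - χ₃ x) * (χ₁ y - χ₂ y) = 0 := by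
    have hxy := hab (x * y)
    rw [h₁, h₂, h₃] at hxy
    linear_combination hxy - χ₂ y * hab x - χ₃ x * hab y
  simpa [hx, hy] using hprod

theorem isNondegenerateSolution_of_isEven {σ : S → S} (hσ : Function.Involutive σ)
    (hs : IsSolution id f g h) (hLI : LinearIndependent ℂ ![f, h]) (hf : IsEven σ f)
    (hg : IsEven σ g) (hh : IsEven σ h) : IsNondegenerateSolution σ f g h where
  isSolution := (isSolution_iff_isSolution_id hσ hf hg hh).2 hs
  linearIndependent := by rwa [hf.evenPart_eq, hh.evenPart_eq]

theorem FamilyA.isNondegenerateSolution {σ : S → S} (hσ : Function.Involutive σ)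
    (H : FamilyA σ f g h) : IsNondegenerateSolution σ f g h := by
  obtain ⟨χ, φ, ψ, -, hχe, -, -, hφe, hφ0, ⟨hφ, hψ⟩, hψe, -, rfl, rfl, rfl⟩ := H
  have hLI : LinearIndependent ℂ ![f, h] := by
    refine linearIndependent_pair_of_forall_left hφ0 fun a b hab => ?_
    obtain ⟨w, hw : h w ≠ 0⟩ := Function.ne_iff.1 hφ0
    have hww : a * h w ^ 2 = 0 := by
      have hab_sq := hab (w * w)
      rw [hφ, show f (w * w) = _ from hψ w w] at hab_sq
      linear_combination hab_sq - 2 * g w * hab w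
    simpa [hw] using hww
  exact isNondegenerateSolution_of_isEven hσ hψ hLI hψe hχe hφe

theorem FamilyB.isNondegenerateSolution {σ : S → S} (hσ : Function.Involutive σ)
    (H : FamilyB σ f g h) : IsNondegenerateSolution σ f g h := by
  obtain ⟨μ, χ, φ, c, hμ, hμe, hχ, hχe, -, hne, hφ, hφe, hφ0, hc, rfl, rfl, rfl⟩ := H
  refine isNondegenerateSolution_of_isEven hσ (fun x y => ?_) ?_
    (((hμe.smul _).sub (hχe.smul _)).sub (hφe.smul _)) hχe ((hμe.smul _).sub (hχe.smul _))
  · simp only [id, Pi.sub_apply, Pi.smul_apply, smul_eq_mul, hμ x, hχ x, hφ x]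
    ring
  · have hLI := linearIndependent_sub_of_isAdditiveFor hχ hμ hφ hne.symm hφ0
    have hdet : c ^ 2 * 0 ≠ -c * c := by simp [hc]
    exact linearIndependent_pair_of_eq_combination hLI hdet (by module) (by module)

theorem FamilyC.isNondegenerateSolution {σ : S → S} (hσ : Function.Involutive σ)
    (H : FamilyC σ f g h) : IsNondegenerateSolution σ f g h := by
  obtain ⟨μ, χ, φ, a, b, hμ, hμe, hχ, hχe, -, hne, hφ, hφe, hφ0, ha, -, hab, rfl, rfl, rfl⟩ := H
  refine isNondegenerateSolution_of_isEven hσ (fun x y => ?_) ?_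
    (((hμe.smul _).add (hχe.smul _)).sub (hφe.smul _))
    (((hμe.smul _).add (hχe.smul _)).sub (hφe.smul _)) hφe
  · simp only [id, Pi.add_apply, Pi.sub_apply, Pi.smul_apply, smul_eq_mul, hμ x, hχ x, hφ x]
    linear_combination -(h x * h y) * hab
  · have hLI := linearIndependent_sub_of_isAdditiveFor hχ hμ hφ hne.symm hφ0
    have hdet : -a * 1 ≠ -(a * b) * 0 := by simp [ha]
    exact linearIndependent_pair_of_eq_combination hLI hdet (by module) (by module)

theorem FamilyD.isNondegenerateSolution {σ : S → S} (hσ : Function.Involutive σ)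
    (H : FamilyD σ f g h) : IsNondegenerateSolution σ f g h := by
  obtain ⟨χ₁, χ₂, χ₃, α, l, ρ, h₁, h₁e, h₂, h₂e, h₃, h₃e, h₁₂, h₁₃, h₂₃, hα, hl, -, hrel, rfl,
    rfl, rfl⟩ := H
  refine isNondegenerateSolution_of_isEven hσ (fun x y => ?_) ?_
    (((h₁e.smul _).add (h₂e.smul _)).sub (h₃e.smul _))
    (((h₁e.smul _).add (h₂e.smul _)).add (h₃e.smul _)) ((h₁e.smul _).sub (h₂e.smul _))
  · simp only [id, Pi.add_apply, Pi.sub_apply, Pi.smul_apply, smul_eq_mul, h₁ x, h₂ x, h₃ x]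
    field_simp
    linear_combination (4 * (χ₁ x - χ₂ x) * (χ₁ y - χ₂ y)) * hrel
  · have hLI := linearIndependent_sub_of_isMultiplicative h₁ h₂ h₃ h₁₂ h₁₃ h₂₃
    have hdet : α * ρ * -(1 / (2 * l)) ≠ α * (2 - ρ) * (1 / (2 * l)) := by
      rw [Ne, ← sub_eq_zero]
      have hsub : α * ρ * -(1 / (2 * l)) - α * (2 - ρ) * (1 / (2 * l)) = -α / l := by
        field_simp
        ring
      rw [hsub]
      exact div_ne_zero (neg_ne_zero.2 hα) hl
    exact linearIndependent_pair_of_eq_combination hLI hdet (by module) (by module)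

theorem FamilyE.isNondegenerateSolution {σ : S → S} (hσ : Function.Involutive σ)
    (H : FamilyE σ f g h) : IsNondegenerateSolution σ f g h := by
  obtain ⟨f, g, h, δ, H | H | H | H, rfl, rfl, rfl⟩ := H
  all_goals exact (H.isNondegenerateSolution hσ).twist δ

theorem isNondegenerateSolution_of_null {σ : S ≃* S} (hσ : Function.Involutive σ)
    (hs : IsSolution σ f 0 h) (hh : IsAdditiveFor 0 h) (hodd : ¬ IsOdd σ h) :
    IsNondegenerateSolution σ f 0 h := by
  have hhe : evenPart σ h ≠ 0 := mt isOdd_of_evenPart_eq_zero hodd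
  refine ⟨hs, linearIndependent_pair_of_forall_left hhe fun a b hab => ?_⟩
  obtain ⟨w, hw : evenPart σ h w ≠ 0⟩ := Function.ne_iff.1 hhe
  have hf : ∀ x y, f (x * σ y) = h x * h y := fun x y => by simpa using hs x y
  have hhmul : ∀ x y, h (x * y) = 0 := fun x y => by simpa using hh x y
  have hprod : ∀ x y, a * (h x * h y + h (σ x) * h (σ y)) = 0 := fun x y => by
    have hxy := hab (x * σ y)
    rw [evenPart, evenPart, map_mul, hf, hf, hhmul, hhmul] at hxy
    linear_combination 2 * hxy
  have hww : a * evenPart σ h w ^ 2 = 0 := by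
    have hwσw := hprod w (σ w)
    rw [hσ] at hwσw
    rw [evenPart]
    linear_combination (hprod w w + hwσw) / 4
  simpa [hw] using hww

theorem FamilyF.isNondegenerateSolution {σ : S ≃* S} (hσ : Function.Involutive σ)
    (H : FamilyF σ f g h) : IsNondegenerateSolution σ f g h := by
  obtain ⟨Φ, Ψ, k, β, hΦ, hΦ0, ⟨-, hΨ⟩, -, hk, -, hparity, rfl, rfl, rfl⟩ := H
  have hs : IsSolution σ (Ψ + k) 0 Φ := fun x y => by
    simpa [hΨ x] using hk x (σ y)
  have hodd : ¬ IsOdd σ Φ := by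
    intro hodd
    obtain ⟨heven, -⟩ | ⟨-, hnot⟩ := hparity
    · exact hΦ0 (self_eq_neg.1 (heven.symm.trans hodd))
    · exact hnot hodd
  convert (isNondegenerateSolution_of_null hσ hs hΦ hodd).twist β using 1
  · rw [twistG]
    module
  · rw [twistH]
    module

theorem FamilyG.isNondegenerateSolution {σ : S ≃* S} (H : FamilyG σ f g h) :
    IsNondegenerateSolution σ f g h := by
  obtain ⟨μ, Φ, k, c, β, hμ, hμe, hμ0, hΦ, hΦe, hΦ0, hk, hko, hc, rfl, rfl, rfl⟩ := H
  have hs : IsSolution σ (c ^ 2 • μ - c • Φ + k) 0 (c • μ) := fun x y => by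
    simp only [Pi.add_apply, Pi.sub_apply, Pi.smul_apply, Pi.zero_apply, smul_eq_mul, hμ x, hΦ x,
      hk x, isEven_iff.1 hμe]
    ring
  have hzero : IsMultiplicative (0 : S → ℂ) := fun x y => by simp
  have hk0 : evenPart σ k = 0 := funext fun x => by
    simp [evenPart, isOdd_iff.1 hko x]
  have H₀ : IsNondegenerateSolution σ (c ^ 2 • μ - c • Φ + k) 0 (c • μ) := by
    refine ⟨hs, ?_⟩
    rw [evenPart_add, hk0, add_zero, ((hμe.smul _).sub (hΦe.smul _)).evenPart_eq,
      (hμe.smul c).evenPart_eq]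
    have hLI := linearIndependent_sub_of_isAdditiveFor hzero hμ hΦ hμ0 hΦ0
    have hdet : c ^ 2 * 0 ≠ -c * c := by simp [hc]
    exact linearIndependent_pair_of_eq_combination hLI hdet (by module) (by module)
  convert H₀.twist β using 1
  · rw [twistG]
    module
  · rw [twistH]
    module

end Families

end CosSine

theorem theorem4p3 {S : Type*} [Semigroup S] (σ : S ≃* S) (hσ : ∀ x, σ (σ x) = x)
    (f g h : S → ℂ) :
    (CosSine.IsSolution σ f g h ∧
      LinearIndependent ℂ ![CosSine.evenPart σ f, CosSine.evenPart σ h]) ↔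
    (CosSine.FamilyA σ f g h ∨ CosSine.FamilyB σ f g h ∨ CosSine.FamilyC σ f g h ∨
      CosSine.FamilyD σ f g h ∨ CosSine.FamilyE σ f g h ∨ CosSine.FamilyF σ f g h ∨
      CosSine.FamilyG σ f g h) := by
  constructor
  · rintro ⟨hs, hLI⟩
    have H : CosSine.IsNondegenerateSolution σ f g h := ⟨hs, hLI⟩
    obtain ⟨δ, hδ⟩ | hE : (∃ δ, CosSine.twistG δ f g h = 0) ∨ CosSine.FamilyE σ f g h := by
      obtain hδ | ⟨hf, hg, hh⟩ := H.exists_twistG_eq_zero_or_isEven hσ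
      · exact Or.inl hδ
      · exact CosSine.exists_twistG_eq_zero_or_familyE_of_isEven hσ H hf hg hh
    · have hFG := H.familyF_or_familyG_of_twistG_eq_zero hσ hδ
      tauto
    · tauto
  · intro hfamily
    have H : CosSine.IsNondegenerateSolution σ f g h := by
      obtain H | H | H | H | H | H | H := hfamily
      on_goal 7 => exact H.isNondegenerateSolution
      all_goals exact H.isNondegenerateSolution hσ
    exact ⟨H.isSolution, H.linearIndependent⟩
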